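/- **Setting.** Let $W\subset\mathbb R^n$ be a compact polyhedron with non-empty interior such that any two of its codimension-one faces that meet form a dihedral angle $\pi/m$ for some positive integer $m$, and let $\Lambda\subset \mathrm{Isom}(\mathbb R^n)$ be the Coxeter group generated by the reflections in the codimension-one faces of $W$; the translates $aW$, $a\in\Lambda$, tessellate $\mathbb R^n$. A *Euclidean building* $\tilde X$ with model chamber $W$ is a polyhedral complex with a CAT(0) metric, together with a labelling of its faces by the faces of $W$, given by a folding map $\rho:\tilde X\to W$ that restricts to an isometry of every chamber (top-dimensional cell) onto $W$, such that (i) any two points of $\tilde X$ lie in an *apartment*, that is, in the image of an isometric, polyhedral, label-preserving embedding of the tessellated $\mathbb R^n$; and (ii) for any two apartments $A_1,A_2$ with $A_1\cap A_2\neq\emptyset$ there is a label-preserving isometry $A_1\to A_2$ that fixes $A_1\cap A_2$ pointwise. The *type* of a point $x$ is $\rho(x)\in W$. Let $\Gamma$ be a group of label-preserving isometries of $\tilde X$ that acts freely and with compact quotient $X=\tilde X/\Gamma$. Give $X$ the quotient metric; types are defined on $X$, since $\rho$ is $\Gamma$-invariant. A *geodesic* in $X$ from $x$ to $y$ is a unit-speed,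 locally distance-minimizing $\gamma:[0,L]\to X$ with $L>0$, $\gamma(0)=x$, $\gamma(L)=y$. A set $F\subset X$ blocks the light from $x$ to $y$ if $\gamma((0,L))\cap F\ne\emptyset$ for every geodesic $\gamma$ from $x$ to $y$ with $x,y\notin\gamma((0,L))$. The blocking number $b(x,y)$ is the least number of points of a blocking set, and $X$ has *uniform finite blocking* if the numbers $b(x,y)$, $x,y\in X$, are finite and bounded above by one constant. For $u,v\in W$ let $T(u,v)\subset W$ be the set of all $w\in W$ such that the orbit $\Lambda w$ contains a midpoint $(\bar u+\bar v)/2$ with $\bar u\in\Lambda u$ and $\bar v\in\Lambda v$. **Theorem.** The compact quotient $X$ has uniform finite blocking. Moreover there is a constant $N$ such that for all $x,y\in X$ (possibly equal): 1. the set of types $T(\rho(x),\rho(y))$ has at most $N$ elements; 2. there are at most $N$ points of $X$ with type in $T(\rho(x),\rho(y))$; 3. for every geodesic $\gamma:[0,L]\to X$ from $x$ to $y$, the midpoint $\gamma(L/2)$ is one of these points, that is, its type belongs to $T(\rho(x),\rho(y))$. -/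

import Mathlib

noncomputable section

/-! ## Coxeter polyhedra and their reflection groups -/

/-- A compact polyhedron with non-empty interior in Euclidean `n`-space, presented as the
intersection of the half-spaces `⟪normal i, x⟫ ≤ offset i` (unit outward normals), none of which is
redundant, such that any two codimension-one faces that meet form an interior dihedral angle
`π / m` with `m` a positive integer. -/
structure CoxeterPolyhedron (n : ℕ) where
  /-- the number of codimension-one faces -/
  numFacets : ℕ
  /-- the outward unit normals -/
  normal : Fin numFacets → EuclideanSpace ℝ (Fin n)
  /-- the offsets of the supporting hyperplanes -/
  offset : Fin numFacets → ℝ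
  norm_normal : ∀ i, ‖normal i‖ = 1
  isCompact : IsCompact {x : EuclideanSpace ℝ (Fin n) | ∀ i, inner ℝ (normal i) x ≤ offset i}
  exists_interior : ∃ x, ∀ i, inner ℝ (normal i) x < offset i
  /-- every hyperplane carries a codimension-one face of its own -/
  exists_facet : ∀ i, ∃ x, inner ℝ (normal i) x = offset i ∧
    ∀ j, j ≠ i → inner ℝ (normal j) x < offset j
  /-- the interior angle between two facets is the supplement of the angle between the outward
  normals -/
  dihedral : ∀ i j, i ≠ j →
    (∃ x, (∀ k, inner ℝ (normal k) x ≤ offset k) ∧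
      inner ℝ (normal i) x = offset i ∧ inner ℝ (normal j) x = offset j) →
    ∃ m : ℕ, 0 < m ∧
      Real.pi - InnerProductGeometry.angle (normal i) (normal j) = Real.pi / m

namespace CoxeterPolyhedron

variable {n : ℕ} (W : CoxeterPolyhedron n)

/-- The polyhedron as a set of points. -/
def carrier : Set (EuclideanSpace ℝ (Fin n)) :=
  {x | ∀ i, inner ℝ (W.normal i) x ≤ W.offset i}

/-- The face of `W` cut out by a set `J` of supporting hyperplanes (`J = ∅` gives `W` itself). -/
def face (J : Set (Fin W.numFacets)) : Set (EuclideanSpace ℝ (Fin n)) :=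
  {x | x ∈ W.carrier ∧ ∀ j ∈ J, inner ℝ (W.normal j) x = W.offset j}

/-- The hyperplane that supports the `i`-th codimension-one face. -/
def wall (i : Fin W.numFacets) : AffineSubspace ℝ (EuclideanSpace ℝ (Fin n)) :=
  AffineSubspace.mk' (W.offset i • W.normal i) (Submodule.span ℝ {W.normal i})ᗮ

instance wall_nonempty (i : Fin W.numFacets) : Nonempty (W.wall i) :=
  ⟨⟨_, AffineSubspace.self_mem_mk' _ _⟩⟩

theorem mem_wall (i : Fin W.numFacets) (x : EuclideanSpace ℝ (Fin n)) :
    x ∈ W.wall i ↔ inner ℝ (W.normal i) x = W.offset i := by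
  simp only [wall, AffineSubspace.mem_mk', vsub_eq_sub, Submodule.mem_orthogonal_singleton_iff_inner_right,
    inner_sub_right, real_inner_smul_right, real_inner_self_eq_norm_sq, W.norm_normal]
  constructor <;> intro h <;> linarith

/-- The orthogonal reflection in the hyperplane that supports the `i`-th codimension-one face. -/
def faceReflection (i : Fin W.numFacets) :
    EuclideanSpace ℝ (Fin n) ≃ᵃⁱ[ℝ] EuclideanSpace ℝ (Fin n) :=
  EuclideanGeometry.reflection (W.wall i)

/-- The Coxeter group generated by the reflections in the codimension-one faces of `W`. -/
def coxeterGroup : Subgroup (EuclideanSpace ℝ (Fin n) ≃ᵃⁱ[ℝ] EuclideanSpace ℝ (Fin n)) :=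
  Subgroup.closure (Set.range W.faceReflection)

/-- The types of the midpoints of the points of type `u` with the points of type `v` in the
Coxeter tessellation: all `w ∈ W` such that some midpoint of a point of the orbit of `u` and a
point of the orbit of `v` lies in the orbit of `w`. -/
def midpointTypes (u v : EuclideanSpace ℝ (Fin n)) : Set (EuclideanSpace ℝ (Fin n)) :=
  {w | w ∈ W.carrier ∧ ∃ a ∈ W.coxeterGroup, ∃ b ∈ W.coxeterGroup, ∃ c ∈ W.coxeterGroup,
    c w = midpoint ℝ (a u) (b v)}

end CoxeterPolyhedron

/-! ## CAT(0) spaces -/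

/-- `c`, restricted to `[0, 1]`, is a minimizing geodesic from `x` to `y`, parametrized
proportionally to arc length. -/
def IsMinimizingGeodesic {X : Type*} [MetricSpace X] (c : ℝ → X) (x y : X) : Prop :=
  c 0 = x ∧ c 1 = y ∧
    ∀ s ∈ Set.Icc (0 : ℝ) 1, ∀ t ∈ Set.Icc (0 : ℝ) 1, dist (c s) (c t) = |s - t| * dist x y

/-- A CAT(0) space: a geodesic metric space in which any two points, on two sides of a geodesic
triangle, are at most as far apart as the corresponding points of the comparison triangle in the
Euclidean plane. -/
def IsCAT0 (X : Type*) [MetricSpace X] : Prop :=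
  (∀ x y : X, ∃ c : ℝ → X, IsMinimizingGeodesic c x y) ∧
  ∀ (x y z : X) (c d : ℝ → X), IsMinimizingGeodesic c x y → IsMinimizingGeodesic d x z →
    ∀ x' y' z' : EuclideanSpace ℝ (Fin 2),
      dist x' y' = dist x y → dist x' z' = dist x z → dist y' z' = dist y z →
      ∀ s ∈ Set.Icc (0 : ℝ) 1, ∀ t ∈ Set.Icc (0 : ℝ) 1,
        dist (c s) (d t) ≤ dist (AffineMap.lineMap x' y' s) (AffineMap.lineMap x' z' t)

/-! ## Euclidean buildings -/

/-- A polyhedral complex on the metric space `X`, with all chambers isometric to `W`, whose faces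
are labelled by the faces of `W`. The labelling is recorded by the folding map `type` onto `W`: it
restricts to an isometry of every chamber `C` onto `W`, and the face of `C` with the label
`W.face J` is `{x ∈ C | type x ∈ W.face J}`. -/
structure LabelledComplex {n : ℕ} (W : CoxeterPolyhedron n) (X : Type*) [MetricSpace X] where
  /-- the chambers, that is, the top-dimensional polyhedra -/
  chambers : Set (Set X)
  /-- the canonical folding map -/
  type : X → EuclideanSpace ℝ (Fin n)
  exists_chamber : ∀ x, ∃ C ∈ chambers, x ∈ C
  dist_type : ∀ C ∈ chambers, ∀ x ∈ C, ∀ y ∈ C, dist (type x) (type y) = dist x y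
  type_image : ∀ C ∈ chambers, type '' C = W.carrier
  /-- chambers that meet do so along a common face -/
  inter_chambers : ∀ C ∈ chambers, ∀ C' ∈ chambers, (C ∩ C').Nonempty →
    ∃ J : Set (Fin W.numFacets), C ∩ C' = {x | x ∈ C ∧ type x ∈ W.face J}

namespace LabelledComplex

variable {n : ℕ} {W : CoxeterPolyhedron n} {X : Type*} [MetricSpace X]

/-- An isometric, polyhedral, label-preserving embedding of Euclidean space, tessellated by the
translates of `W` under the Coxeter group: every tile is mapped onto a chamber, and the point of
the tile `a W` that corresponds to `w ∈ W` is mapped to a point of type `w`. The images of these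
embeddings are the apartments. -/
def IsApartmentEmbedding (K : LabelledComplex W X) (f : EuclideanSpace ℝ (Fin n) → X) : Prop :=
  Isometry f ∧ ∀ a ∈ W.coxeterGroup,
    f '' (a '' W.carrier) ∈ K.chambers ∧ ∀ w ∈ W.carrier, K.type (f (a w)) = w

/-- The group of label-preserving isometries. -/
def isom (K : LabelledComplex W X) : Subgroup (X ≃ᵢ X) where
  carrier := {g | ∀ x, K.type (g x) = K.type x}
  mul_mem' := by
    intro g h hg hh x
    exact (hg (h x)).trans (hh x)
  one_mem' := fun _ => rfl
  inv_mem' := by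
    intro g hg x
    have h := hg (g⁻¹ x)
    rw [IsometryEquiv.apply_inv_self] at h
    exact h.symm

end LabelledComplex

/-- A Euclidean building with model chamber `W`: a labelled polyhedral complex with a CAT(0)
metric, in which any two points lie in an apartment, and any two apartments that meet are related
by a label-preserving isometry that fixes their intersection pointwise. (In the last axiom the
isometry from `range f` to `range g` is `g' ∘ f⁻¹`; it is not required to extend to the whole
building.) -/
structure EuclideanBuilding {n : ℕ} (W : CoxeterPolyhedron n) (X : Type*) [MetricSpace X] extends
    LabelledComplex W X where
  isCAT0 : IsCAT0 X
  exists_apartment : ∀ x y : X, ∃ f : EuclideanSpace ℝ (Fin n) → X,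
    toLabelledComplex.IsApartmentEmbedding f ∧ x ∈ Set.range f ∧ y ∈ Set.range f
  apartment_iso : ∀ f g : EuclideanSpace ℝ (Fin n) → X,
    toLabelledComplex.IsApartmentEmbedding f → toLabelledComplex.IsApartmentEmbedding g →
    (Set.range f ∩ Set.range g).Nonempty →
    ∃ g' : EuclideanSpace ℝ (Fin n) → X,
      toLabelledComplex.IsApartmentEmbedding g' ∧ Set.range g' = Set.range g ∧
      ∀ p, f p ∈ Set.range g → g' p = f p

/-! ## Quotients by groups of isometries -/

/-- The equivalence relation whose classes are the orbits of `Γ`. -/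
def orbitSetoid {X : Type*} [MetricSpace X] (Γ : Subgroup (X ≃ᵢ X)) : Setoid X where
  r x y := ∃ g ∈ Γ, g x = y
  iseqv :=
    { refl := fun _ => ⟨1, Γ.one_mem, rfl⟩
      symm := by
        rintro x y ⟨g, hg, rfl⟩
        exact ⟨g⁻¹, Γ.inv_mem hg, IsometryEquiv.inv_apply_self g x⟩
      trans := by
        rintro x y z ⟨g, hg, rfl⟩ ⟨h, hh, rfl⟩
        exact ⟨h * g, Γ.mul_mem hh hg, rfl⟩ }

/-- The quotient of `X` by the group `Γ` of isometries. -/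
def OrbitSpace {X : Type*} [MetricSpace X] (Γ : Subgroup (X ≃ᵢ X)) : Type _ :=
  Quotient (orbitSetoid Γ)

namespace OrbitSpace

variable {X : Type*} [MetricSpace X] {Γ : Subgroup (X ≃ᵢ X)}

/-- The projection to the quotient. -/
def mk (Γ : Subgroup (X ≃ᵢ X)) (x : X) : OrbitSpace Γ :=
  Quotient.mk (orbitSetoid Γ) x

theorem mk_surjective : Function.Surjective (mk Γ) :=
  Quotient.mk_surjective

theorem mk_eq_mk {x y : X} : mk Γ x = mk Γ y ↔ ∃ g ∈ Γ, g x = y :=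
  Quotient.eq

/-- The quotient distance: the infimum of the distances between representatives. -/
def qdist (p q : OrbitSpace Γ) : ℝ :=
  sInf {r | ∃ x y : X, mk Γ x = p ∧ mk Γ y = q ∧ r = dist x y}

theorem qdist_bddBelow (p q : OrbitSpace Γ) :
    BddBelow {r | ∃ x y : X, mk Γ x = p ∧ mk Γ y = q ∧ r = dist x y} := by
  refine ⟨0, ?_⟩
  rintro r ⟨x, y, -, -, rfl⟩
  exact dist_nonneg

theorem qdist_nonempty (p q : OrbitSpace Γ) :
    {r | ∃ x y : X, mk Γ x = p ∧ mk Γ y = q ∧ r = dist x y}.Nonempty := by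
  obtain ⟨x, hx⟩ := mk_surjective p
  obtain ⟨y, hy⟩ := mk_surjective q
  exact ⟨_, x, y, hx, hy, rfl⟩

/-- The quotient of `X` with the quotient distance, the infimum of the distances between
representatives. (It is a metric as soon as the orbits are closed.) -/
instance : PseudoMetricSpace (OrbitSpace Γ) where
  dist := qdist
  dist_self p := by
    apply le_antisymm
    · obtain ⟨x, hx⟩ := mk_surjective p
      exact csInf_le (qdist_bddBelow p p) ⟨x, x, hx, hx, (dist_self x).symm⟩
    · refine le_csInf (qdist_nonempty p p) ?_
      rintro r ⟨x, y, -, -, rfl⟩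
      exact dist_nonneg
  dist_comm p q := by
    have h : ∀ p q : OrbitSpace Γ, qdist p q ≤ qdist q p := by
      intro p q
      refine le_csInf (qdist_nonempty q p) ?_
      rintro r ⟨x, y, hx, hy, rfl⟩
      exact csInf_le (qdist_bddBelow p q) ⟨y, x, hy, hx, dist_comm x y⟩
    exact le_antisymm (h p q) (h q p)
  dist_triangle p q r := by
    have key : ∀ s ∈ {s | ∃ x y : X, mk Γ x = p ∧ mk Γ y = q ∧ s = dist x y},
        ∀ t ∈ {t | ∃ x y : X, mk Γ x = q ∧ mk Γ y = r ∧ t = dist x y}, qdist p r - s ≤ t := by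
      rintro s ⟨x, y, hx, hy, rfl⟩ t ⟨y', z, hy', hz, rfl⟩
      obtain ⟨g, hg, hgy⟩ := mk_eq_mk.1 (hy.trans hy'.symm)
      have hgx : mk Γ (g x) = p := by
        rw [← hx]
        exact (mk_eq_mk.2 ⟨g, hg, rfl⟩).symm
      have h1 : qdist p r ≤ dist (g x) z := csInf_le (qdist_bddBelow p r) ⟨g x, z, hgx, hz, rfl⟩
      have h2 : dist (g x) y' = dist x y := by rw [← hgy, g.dist_eq]
      have h3 := dist_triangle (g x) y' z
      linarith
    have h4 : ∀ s ∈ {s | ∃ x y : X, mk Γ x = p ∧ mk Γ y = q ∧ s = dist x y},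
        qdist p r - qdist q r ≤ s := by
      intro s hs
      have : qdist p r - s ≤ qdist q r := le_csInf (qdist_nonempty q r) (key s hs)
      linarith
    have h5 : qdist p r - qdist q r ≤ qdist p q := le_csInf (qdist_nonempty p q) h4
    linarith

theorem dist_eq (p q : OrbitSpace Γ) :
    dist p q = sInf {r | ∃ x y : X, mk Γ x = p ∧ mk Γ y = q ∧ r = dist x y} :=
  rfl

end OrbitSpace

/-- The folding map of a quotient by label-preserving isometries. -/
def LabelledComplex.quotientType {n : ℕ} {W : CoxeterPolyhedron n} {X : Type*} [MetricSpace X]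
    (K : LabelledComplex W X) (Γ : Subgroup (X ≃ᵢ X)) (hΓ : Γ ≤ K.isom) :
    OrbitSpace Γ → EuclideanSpace ℝ (Fin n) :=
  Quotient.lift K.type (by
    rintro x y ⟨g, hg, rfl⟩
    exact (hΓ hg x).symm)

/-! ## Blocking light -/

section Blocking

variable {Y : Type*} [PseudoMetricSpace Y]

/-- `γ`, restricted to `[0, L]` with `L > 0`, is a geodesic segment of length `L` with its unit
speed parametrization. Geodesics are locally (not necessarily globally) distance-minimizing. -/
def IsGeodesicSegment (γ : ℝ → Y) (L : ℝ) : Prop :=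
  0 < L ∧ ∀ t ∈ Set.Icc 0 L, ∃ ε > 0, ∀ s ∈ Set.Icc 0 L, ∀ s' ∈ Set.Icc 0 L,
    |s - t| < ε → |s' - t| < ε → dist (γ s) (γ s') = |s - s'|

/-- The geodesic segments from `A` to `B`. -/
def IsGeodesicFromTo (A B : Set Y) (γ : ℝ → Y) (L : ℝ) : Prop :=
  IsGeodesicSegment γ L ∧ γ 0 ∈ A ∧ γ L ∈ B

/-- The light from `A` to `B`: the geodesic segments from `A` to `B` with interior disjoint from
`A ∪ B`. -/
def IsLight (A B : Set Y) (γ : ℝ → Y) (L : ℝ) : Prop :=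
  IsGeodesicFromTo A B γ L ∧ Disjoint (γ '' Set.Ioo 0 L) (A ∪ B)

/-- `F` blocks the light from `A` to `B`. -/
def IsBlockingSet (F A B : Set Y) : Prop :=
  ∀ (γ : ℝ → Y) (L : ℝ), IsLight A B γ L → (γ '' Set.Ioo 0 L ∩ F).Nonempty

/-- The blocking number of two points: the least number of points that block the light from `x`
to `y`, or `⊤` if there is no finite blocking set. -/
def blockingNumber (x y : Y) : ℕ∞ :=
  sInf {N | ∃ F : Set Y, IsBlockingSet F {x} {y} ∧ F.encard = N}

variable (Y) in
/-- All blocking numbers are finite. -/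
def FiniteBlocking : Prop :=
  ∀ x y : Y, blockingNumber x y < ⊤

variable (Y) in
/-- All blocking numbers are finite, and they are uniformly bounded above. -/
def UniformFiniteBlocking : Prop :=
  FiniteBlocking Y ∧ ∃ N : ℕ, ∀ x y : Y, blockingNumber x y ≤ N

end Blocking

end

/-!
Let `Λ` be the Coxeter group of `W`. Three facts carry the proof.

**Midpoint types are bounded in number.** Every apartment gives a folding map of Euclidean space,
left inverse to every `a : W → a W`, `a ∈ Λ` (`CoxeterPolyhedron.IsFolding`). This alone makes `W`
a strict fundamental domain of a discrete group: an element that keeps an interior point in the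
interior is `1`, so orbits are locally finite, and the point of an orbit closest to an interior
point of `W` lies in `W`, because reflections in walls bring points outside `W` closer. Any two
nonparallel mirrors meet, up to `Λ`, in a point of `W`, so the inner products of the normals of
mirrors take finitely many values; hence there are finitely many normals and the point group is
finite. So the translations `t ∈ Λ`, and also the translations by `2 t`, form subgroups of finite
index. Up to `Λ` a midpoint is `(u + b v) / 2` with `b ∈ Λ`, and changing `b` by the translation by
`2 t` moves it by `t`. Therefore the number of types is at most the index of the subgroup of the
doubled translations (`IsFolding.exists_encard_midpointTypes_le`).

**The quotient has boundedly many points of each type.** Points of the type of a fixed interior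
point `p` of `W` are uniformly separated, so by compactness the quotient has finitely many. A point
`x` of type `w` in a chamber with `p`-point `c` is the only point of type `w` at distance `‖w - p‖`
from `c`, so there are no more points of type `w` than of type `p`
(`EuclideanBuilding.exists_encard_quotientType_le`).

**Midpoints of geodesics.** By freeness and compactness `Γ` moves all points by a definite amount, so
the projection is locally isometric and finely spaced points of a geodesic of the quotient lift to a
chain of points that is straight at each of them. In a CAT(0) space such a chain is as long as the
distance of its ends (`IsCAT0.dist_chain`), and midpoints are unique. So the lifted midpoint is the
midpoint in any apartment that contains the two ends, where its type is one of the midpoint types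
(`EuclideanBuilding.quotientType_midpoint_mem`).

The points with these types then block the light, as every geodesic passes through its midpoint.
-/

/-! ### Separated sets and discrete geodesics in CAT(0) spaces -/

theorem finite_of_separated {Y : Type*} [PseudoMetricSpace Y] {s : Set Y} {r : ℝ} (hr : 0 < r)
    (hs : TotallyBounded s) (h : ∀ x ∈ s, ∀ y ∈ s, dist x y < r → x = y) : s.Finite := by
  obtain ⟨t, ht, hst⟩ := Metric.totallyBounded_iff.1 hs (r / 2) (half_pos hr)
  refine (ht.biUnion (t := fun y => Metric.ball y (r / 2) ∩ s) fun y _ => ?_).subset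
    fun x hx => ?_
  · refine Set.Subsingleton.finite fun a ha b hb => h a ha.2 b hb.2 ?_
    have h1 := Metric.mem_ball.1 ha.1
    have h2 := Metric.mem_ball'.1 hb.1
    have h3 := dist_triangle a y b
    linarith
  · obtain ⟨y, hy, hxy⟩ := Set.mem_iUnion₂.1 (hst hx)
    exact Set.mem_biUnion hy ⟨hxy, hx⟩

/-- Stewart's theorem. -/
theorem dist_lineMap_sq {V : Type*} [NormedAddCommGroup V] [InnerProductSpace ℝ V] (x y z : V)
    (s : ℝ) : dist (AffineMap.lineMap x y s) z ^ 2 =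
      (1 - s) * dist x z ^ 2 + s * dist y z ^ 2 - s * (1 - s) * dist x y ^ 2 := by
  have e1 : AffineMap.lineMap x y s - z = (1 - s) • (x - z) + s • (y - z) := by
    rw [AffineMap.lineMap_apply_module]; module
  have e2 : x - y = (x - z) - (y - z) := by abel
  have e3 := norm_sub_sq_real (x - z) (y - z)
  rw [dist_eq_norm, dist_eq_norm, dist_eq_norm, dist_eq_norm, e1, e2, e3, norm_add_sq_real,
    norm_smul, norm_smul, real_inner_smul_left, real_inner_smul_right, mul_pow,
    mul_pow, Real.norm_eq_abs, Real.norm_eq_abs, sq_abs, sq_abs]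
  ring

theorem exists_comparison_triangle {X : Type*} [MetricSpace X] (x y z : X) :
    ∃ x' y' z' : EuclideanSpace ℝ (Fin 2),
      dist x' y' = dist x y ∧ dist x' z' = dist x z ∧ dist y' z' = dist y z := by
  have ha : 0 ≤ dist x y := dist_nonneg
  have hb : 0 ≤ dist x z := dist_nonneg
  have hc : 0 ≤ dist y z := dist_nonneg
  have h1 := dist_triangle x y z
  have h2 := dist_triangle x z y
  have h3 := dist_triangle y x z
  rw [dist_comm z y] at h2
  rw [dist_comm y x] at h3
  generalize dist x y = a at *
  generalize dist x z = b at *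
  generalize dist y z = c at *
  rcases ha.eq_or_lt with rfl | ha
  · have : b = c := by linarith
    subst this
    refine ⟨0, 0, !₂[b, 0], ?_, ?_, ?_⟩ <;> simp [EuclideanSpace.norm_eq, Real.sqrt_sq hb]
  · set p := (a ^ 2 + b ^ 2 - c ^ 2) / (2 * a) with hp
    have hpa : 2 * a * p = a ^ 2 + b ^ 2 - c ^ 2 := by rw [hp]; field_simp
    have hq : 0 ≤ b ^ 2 - p ^ 2 := by
      have h4 : p ≤ b := by rw [hp, div_le_iff₀ (by positivity)]; nlinarith
      have h5 : -b ≤ p := by rw [hp, le_div_iff₀ (by positivity)]; nlinarith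
      nlinarith
    refine ⟨0, !₂[a, 0], !₂[p, Real.sqrt (b ^ 2 - p ^ 2)], ?_, ?_, ?_⟩
    · simp [EuclideanSpace.norm_eq, Real.sqrt_sq ha.le]
    · simp [EuclideanSpace.norm_eq, Real.sq_sqrt hq, Real.sqrt_sq hb]
    · simp only [EuclideanSpace.dist_eq, Fin.sum_univ_two, Real.dist_eq, sq_abs]
      simp only [Matrix.cons_val_zero, Matrix.cons_val_one, zero_sub, neg_sq,
        Real.sq_sqrt hq]
      rw [show (a - p) ^ 2 + (b ^ 2 - p ^ 2) = c ^ 2 by linear_combination -hpa, Real.sqrt_sq hc]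

namespace IsCAT0

variable {X : Type*} [MetricSpace X]

theorem dist_sq_le (hX : IsCAT0 X) {c : ℝ → X} {x y : X} (hc : IsMinimizingGeodesic c x y) (z : X)
    {s : ℝ} (hs : s ∈ Set.Icc (0 : ℝ) 1) :
    dist (c s) z ^ 2 ≤
      (1 - s) * dist x z ^ 2 + s * dist y z ^ 2 - s * (1 - s) * dist x y ^ 2 := by
  obtain ⟨x', y', z', h1, h2, h3⟩ := exists_comparison_triangle x y z
  obtain ⟨d, hd⟩ := hX.1 x z
  have h := hX.2 x y z c d hc hd x' y' z' h1 h2 h3 s hs 1 ⟨zero_le_one, le_rfl⟩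
  rw [hd.2.1, AffineMap.lineMap_apply_one] at h
  rw [← h1, ← h2, ← h3, ← dist_lineMap_sq]
  gcongr

/-- A point that divides the distance from `x` to `y` lies on every geodesic from `x` to `y`. -/
theorem eq_of_dist_eq (hX : IsCAT0 X) {c : ℝ → X} {x y m : X} (hc : IsMinimizingGeodesic c x y)
    {s : ℝ} (hs : s ∈ Set.Icc (0 : ℝ) 1) (hx : dist x m = s * dist x y)
    (hy : dist y m = (1 - s) * dist x y) : c s = m := by
  have h := hX.dist_sq_le hc m hs
  rw [hx, hy] at h
  have h0 : dist (c s) m ^ 2 ≤ 0 := h.trans_eq (by ring)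
  exact dist_eq_zero.1 (pow_eq_zero_iff two_ne_zero |>.1 (le_antisymm h0 (sq_nonneg _)))

theorem dist_sq_le_of_dist_eq (hX : IsCAT0 X) {x y m : X} {s : ℝ} (hs : s ∈ Set.Icc (0 : ℝ) 1)
    (hx : dist x m = s * dist x y) (hy : dist y m = (1 - s) * dist x y) (z : X) :
    dist m z ^ 2 ≤
      (1 - s) * dist x z ^ 2 + s * dist y z ^ 2 - s * (1 - s) * dist x y ^ 2 := by
  obtain ⟨c, hc⟩ := hX.1 x y
  rw [← hX.eq_of_dist_eq hc hs hx hy]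
  exact hX.dist_sq_le hc z hs

theorem midpoint_unique (hX : IsCAT0 X) {x y m m' : X}
    (h1 : dist x m = dist x y / 2) (h2 : dist y m = dist x y / 2)
    (h1' : dist x m' = dist x y / 2) (h2' : dist y m' = dist x y / 2) : m = m' := by
  obtain ⟨c, hc⟩ := hX.1 x y
  have hs : (1 / 2 : ℝ) ∈ Set.Icc (0 : ℝ) 1 := by constructor <;> norm_num
  rw [← hX.eq_of_dist_eq hc hs (m := m) (by linarith) (by linarith),
    ← hX.eq_of_dist_eq hc hs (m := m') (by linarith) (by linarith)]

/-- Local geodesics are geodesics, in discrete form: a chain of points with steps of length `h`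
that is straight at every interior point has the length `m * h` from end to end. -/
theorem dist_chain (hX : IsCAT0 X) (x : ℕ → X) (m : ℕ) {h : ℝ}
    (h1 : ∀ k < m, dist (x k) (x (k + 1)) = h)
    (h2 : ∀ k, k + 1 < m → dist (x k) (x (k + 2)) = 2 * h) :
    ∀ k ≤ m, dist (x 0) (x k) = k * h := by
  have key : ∀ k, k + 1 ≤ m →
      dist (x 0) (x k) = k * h ∧ dist (x 0) (x (k + 1)) = ((k : ℝ) + 1) * h := by
    intro k
    induction k with
    | zero =>
      intro hm
      simpa using h1 0 hm
    | succ k ih =>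
      intro hm
      obtain ⟨ha, hb⟩ := ih (by omega)
      have hstep := h1 (k + 1) hm
      have hh : 0 ≤ h := hstep ▸ dist_nonneg
      have hk : (0 : ℝ) < k + 1 := by positivity
      refine ⟨by rw [hb]; push_cast; ring, le_antisymm ?_ ?_⟩
      · have := dist_triangle (x 0) (x (k + 1)) (x (k + 1 + 1))
        rw [hb, hstep] at this
        push_cast
        linarith
      · -- The point `x k` lies on the side from `x (k + 1)` to `x 0`, so Stewart's inequality
        -- bounds its distance `2 * h` from `x (k + 2)` in terms of the third side.
        have hs : ((k : ℝ) + 1)⁻¹ ∈ Set.Icc (0 : ℝ) 1 :=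
          ⟨by positivity, inv_le_one_of_one_le₀ (by linarith [k.cast_nonneg (α := ℝ)])⟩
        have hd : dist (x (k + 1)) (x 0) = ((k : ℝ) + 1) * h := by rw [dist_comm, hb]
        have h3 := hX.dist_sq_le_of_dist_eq (x := x (k + 1)) (y := x 0) (m := x k) hs
          (by rw [hd, dist_comm, h1 k (by omega)]; field_simp)
          (by rw [hd, ha]; field_simp; ring) (x (k + 2))
        rw [h2 k (by omega), hstep, hd] at h3
        have h4 : (((k : ℝ) + 1 + 1) * h) ^ 2 ≤ dist (x 0) (x (k + 2)) ^ 2 := by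
          have h5 := mul_le_mul_of_nonneg_left h3 hk.le
          have h6 : ((k : ℝ) + 1) * ((1 - ((k : ℝ) + 1)⁻¹) * h ^ 2
              + ((k : ℝ) + 1)⁻¹ * dist (x 0) (x (k + 2)) ^ 2
              - ((k : ℝ) + 1)⁻¹ * (1 - ((k : ℝ) + 1)⁻¹) * (((k : ℝ) + 1) * h) ^ 2)
              = k * h ^ 2 + dist (x 0) (x (k + 2)) ^ 2 - k * (k + 1) * h ^ 2 := by
            field_simp; ring
          rw [h6] at h5
          nlinarith [h5]
        push_cast
        exact le_of_sq_le_sq h4 dist_nonneg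
  intro k hk
  rcases k with _ | k
  · simp
  · rw [(key k hk).2]
    push_cast
    ring

end IsCAT0

/-! ### The Coxeter group of a polyhedron with a folding map -/

namespace CoxeterPolyhedron

variable {n : ℕ} {W : CoxeterPolyhedron n}

variable (W) in
/-- A map that sends the point of the tile `a W` corresponding to `w ∈ W` to `w`. Nothing is said
about points outside the tiles, which do not exist, by `IsFolding.exists_eq_apply`. A building
provides such a map: its labelling restricted to an apartment. -/
def IsFolding (τ : EuclideanSpace ℝ (Fin n) → EuclideanSpace ℝ (Fin n)) : Prop :=
  ∀ a ∈ W.coxeterGroup, ∀ w ∈ W.carrier, τ (a w) = w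

variable (W) in
/-- The points of `W` that lie on none of the supporting hyperplanes. -/
def openCell : Set (EuclideanSpace ℝ (Fin n)) :=
  {x | ∀ i, inner ℝ (W.normal i) x < W.offset i}

theorem openCell_subset : W.openCell ⊆ W.carrier := fun _ hx i => (hx i).le

theorem isOpen_openCell : IsOpen W.openCell := by
  rw [openCell, Set.ofPred_forall]
  exact isOpen_iInter_of_finite fun i => isOpen_lt (by fun_prop) continuous_const

theorem faceReflection_apply (i : Fin W.numFacets) (x : EuclideanSpace ℝ (Fin n)) :
    W.faceReflection i x =
      x - (2 * (inner ℝ (W.normal i) x - W.offset i)) • W.normal i := by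
  set k := inner ℝ (W.normal i) x - W.offset i with hk
  have h1 : x - k • W.normal i ∈ W.wall i := by
    rw [mem_wall, inner_sub_right, real_inner_smul_right, real_inner_self_eq_norm_sq,
      W.norm_normal]
    linarith
  have h2 : k • W.normal i ∈ (W.wall i).directionᗮ := by
    rw [wall, AffineSubspace.direction_mk']
    exact Submodule.le_orthogonal_orthogonal _
      (Submodule.smul_mem _ _ (Submodule.mem_span_singleton_self _))
  have h3 := EuclideanGeometry.reflection_orthogonal_vadd h1 h2
  rw [vadd_eq_add, vadd_eq_add, add_sub_cancel] at h3
  rw [faceReflection, h3]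
  module

theorem faceReflection_mem (i : Fin W.numFacets) : W.faceReflection i ∈ W.coxeterGroup :=
  Subgroup.subset_closure ⟨i, rfl⟩

/-- A point beyond the `i`-th wall comes closer to the open cell by reflection in that wall. -/
theorem dist_faceReflection_lt {p x : EuclideanSpace ℝ (Fin n)} (hp : p ∈ W.openCell)
    {i : Fin W.numFacets} (hx : W.offset i < inner ℝ (W.normal i) x) :
    dist (W.faceReflection i x) p < dist x p := by
  have hpi := hp i
  refine lt_of_pow_lt_pow_left₀ 2 dist_nonneg ?_
  rw [faceReflection_apply, dist_eq_norm, dist_eq_norm, sub_right_comm, norm_sub_sq_real,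
    norm_smul, real_inner_smul_right, W.norm_normal, mul_one, Real.norm_eq_abs, sq_abs,
    real_inner_comm (W.normal i) (x - p), inner_sub_right]
  set k := inner ℝ (W.normal i) x
  set l := inner ℝ (W.normal i) p
  nlinarith [mul_pos (sub_pos.2 hx) (sub_pos.2 hpi)]

theorem exists_dist_le {p : EuclideanSpace ℝ (Fin n)} :
    ∃ D, ∀ w ∈ W.carrier, dist w p ≤ D := by
  obtain ⟨D, hD⟩ := W.isCompact.isBounded.subset_closedBall p
  exact ⟨D, fun w hw => Metric.mem_closedBall.1 (hD hw)⟩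

/-- The normals span, because `W` is bounded. -/
theorem eq_zero_of_inner_normal_eq_zero {v : EuclideanSpace ℝ (Fin n)}
    (hv : ∀ i, inner ℝ (W.normal i) v = 0) : v = 0 := by
  obtain ⟨p, hp⟩ := W.exists_interior
  obtain ⟨D, hD⟩ := W.exists_dist_le (p := p)
  by_contra h
  have hv0 : 0 < ‖v‖ := norm_pos_iff.2 h
  have h1 : p + ((|D| + 1) / ‖v‖) • v ∈ W.carrier := by
    intro i
    rw [inner_add_right, real_inner_smul_right, hv i, mul_zero, add_zero]
    exact (hp i).le
  have h2 := hD _ h1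
  rw [dist_eq_norm, add_sub_cancel_left, norm_smul, Real.norm_eq_abs,
    abs_of_nonneg (by positivity), div_mul_cancel₀ _ hv0.ne'] at h2
  linarith [le_abs_self D]

theorem mul_inv_apply_eq {a b : EuclideanSpace ℝ (Fin n) ≃ᵃⁱ[ℝ] EuclideanSpace ℝ (Fin n)}
    (x : EuclideanSpace ℝ (Fin n)) : (a * b⁻¹) (b x) = a x := by
  simp [AffineIsometryEquiv.coe_mul, AffineIsometryEquiv.coe_inv]

theorem apply_inv_mul_apply {a b : EuclideanSpace ℝ (Fin n) ≃ᵃⁱ[ℝ] EuclideanSpace ℝ (Fin n)}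
    (x : EuclideanSpace ℝ (Fin n)) : a ((a⁻¹ * b) x) = b x :=
  a.apply_symm_apply (b x)

theorem dist_inv_mul_apply {a b : EuclideanSpace ℝ (Fin n) ≃ᵃⁱ[ℝ] EuclideanSpace ℝ (Fin n)}
    (x y : EuclideanSpace ℝ (Fin n)) : dist ((a⁻¹ * b) x) y = dist (b x) (a y) := by
  rw [← a.dist_map, apply_inv_mul_apply]

namespace IsFolding

variable {τ : EuclideanSpace ℝ (Fin n) → EuclideanSpace ℝ (Fin n)}

/-- `W` meets every orbit of the Coxeter group at most once. -/
theorem apply_eq_self (hτ : W.IsFolding τ)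
    {a : EuclideanSpace ℝ (Fin n) ≃ᵃⁱ[ℝ] EuclideanSpace ℝ (Fin n)} (ha : a ∈ W.coxeterGroup)
    {w : EuclideanSpace ℝ (Fin n)} (hw : w ∈ W.carrier) (haw : a w ∈ W.carrier) : a w = w := by
  have h1 := hτ a ha w hw
  have h2 := hτ 1 (one_mem _) (a w) haw
  exact h2.symm.trans h1

theorem eq_one_of_mem_openCell (hτ : W.IsFolding τ)
    {a : EuclideanSpace ℝ (Fin n) ≃ᵃⁱ[ℝ] EuclideanSpace ℝ (Fin n)} (ha : a ∈ W.coxeterGroup)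
    {p : EuclideanSpace ℝ (Fin n)} (hp : p ∈ W.openCell) (hap : a p ∈ W.openCell) : a = 1 := by
  -- On a neighbourhood of `p` the map `a` is the identity.
  have hopen : IsOpen (W.openCell ∩ a ⁻¹' W.openCell) :=
    isOpen_openCell.inter (isOpen_openCell.preimage a.continuous)
  obtain ⟨ε, hε, hball⟩ := Metric.isOpen_iff.1 hopen p ⟨hp, hap⟩
  have hfix : ∀ x ∈ Metric.ball p ε, a x = x := fun x hx =>
    hτ.apply_eq_self ha (openCell_subset (hball hx).1) (openCell_subset (hball hx).2)
  have hlin : ∀ v, a.linearIsometryEquiv v = v := by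
    intro v
    set t := ε / (2 * (‖v‖ + 1)) with ht
    have ht0 : 0 < t := by positivity
    have h1 : t • v + p ∈ Metric.ball p ε := by
      rw [Metric.mem_ball, dist_eq_norm, add_sub_cancel_right, norm_smul, Real.norm_eq_abs,
        abs_of_pos ht0, ht, div_mul_eq_mul_div, div_lt_iff₀ (by positivity)]
      nlinarith [norm_nonneg v]
    have h2 := hfix _ h1
    have h3 := a.map_vadd p (t • v)
    rw [vadd_eq_add, vadd_eq_add, h2, hfix p (Metric.mem_ball_self hε), map_smul] at h3
    exact (smul_right_injective _ ht0.ne' (add_right_cancel h3)).symm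
  ext1 x
  have h := a.map_vadd p (x - p)
  rw [hlin, hfix p (Metric.mem_ball_self hε), vadd_eq_add, sub_add_cancel] at h
  exact h

/-- The Coxeter group acts properly discontinuously. -/
theorem finite_setOf_dist_le (hτ : W.IsFolding τ) (x y : EuclideanSpace ℝ (Fin n)) (R : ℝ) :
    {a | a ∈ W.coxeterGroup ∧ dist (a x) y ≤ R}.Finite := by
  obtain ⟨p, hp⟩ := W.exists_interior
  obtain ⟨r, hr, hball⟩ := Metric.isOpen_iff.1 isOpen_openCell p hp
  have hsep : ∀ a ∈ W.coxeterGroup, ∀ b ∈ W.coxeterGroup, dist (a p) (b p) < r → a = b := by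
    intro a ha b hb h
    have h1 : (b⁻¹ * a) p ∈ W.openCell := hball (by
      rwa [Metric.mem_ball, dist_inv_mul_apply])
    exact (inv_mul_eq_one.1
      (hτ.eq_one_of_mem_openCell (mul_mem (inv_mem hb) ha) hp h1)).symm
  refine Set.Finite.of_finite_image (f := fun a => a p) ?_ ?_
  · refine finite_of_separated hr ((ProperSpace.isCompact_closedBall y
      (dist p x + R)).totallyBounded.subset ?_) ?_
    · rintro _ ⟨a, ⟨ha, haR⟩, rfl⟩
      have h1 := dist_triangle (a p) (a x) y
      rw [a.dist_map] at h1
      exact Metric.mem_closedBall.2 (by linarith)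
    · rintro _ ⟨a, ⟨ha, -⟩, rfl⟩ _ ⟨b, ⟨hb, -⟩, rfl⟩ h
      rw [hsep a ha b hb h]
  · intro a ha b hb h
    have h' : a p = b p := h
    exact hsep a ha.1 b hb.1 (by rw [h', dist_self]; exact hr)

/-- Among the points of an orbit there is one closest to `p`; it lies in `W`, since otherwise a
reflection in a wall brings it closer. -/
theorem exists_min_dist (hτ : W.IsFolding τ) {p : EuclideanSpace ℝ (Fin n)}
    (hp : p ∈ W.openCell) (y : EuclideanSpace ℝ (Fin n)) :
    ∃ a ∈ W.coxeterGroup, a y ∈ W.carrier ∧ ∀ b ∈ W.coxeterGroup, dist (a y) p ≤ dist (b y) p := by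
  have hone : (1 : EuclideanSpace ℝ (Fin n) ≃ᵃⁱ[ℝ] EuclideanSpace ℝ (Fin n)) ∈
      {a | a ∈ W.coxeterGroup ∧ dist (a y) p ≤ dist y p} :=
    ⟨one_mem _, by rw [AffineIsometryEquiv.coe_one, id]⟩
  obtain ⟨a, ⟨ha, -⟩, hmin⟩ := Set.exists_min_image _ (fun a => dist (a y) p)
    (hτ.finite_setOf_dist_le y p (dist y p)) ⟨1, hone⟩
  have hmin' : ∀ b ∈ W.coxeterGroup, dist (a y) p ≤ dist (b y) p := by
    intro b hb
    by_cases h : dist (b y) p ≤ dist y p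
    · exact hmin b ⟨hb, h⟩
    · exact (hmin 1 hone).trans (not_le.1 h).le
  refine ⟨a, ha, fun i => ?_, hmin'⟩
  by_contra! h
  have h1 := hmin' _ (mul_mem (faceReflection_mem i) ha)
  rw [AffineIsometryEquiv.coe_mul, Function.comp_apply] at h1
  exact (dist_faceReflection_lt hp h).not_ge h1

/-- The tiles cover the space. -/
theorem exists_eq_apply (hτ : W.IsFolding τ) (x : EuclideanSpace ℝ (Fin n)) :
    ∃ a ∈ W.coxeterGroup, ∃ w ∈ W.carrier, x = a w := by
  obtain ⟨p, hp⟩ := W.exists_interior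
  obtain ⟨a, ha, hax, -⟩ := hτ.exists_min_dist hp x
  exact ⟨a⁻¹, inv_mem ha, a x, hax, (a.symm_apply_apply x).symm⟩

/-- The point of an orbit in `W` is the only point of the orbit closest to `p`. -/
theorem apply_eq_of_dist_eq (hτ : W.IsFolding τ) {p : EuclideanSpace ℝ (Fin n)}
    (hp : p ∈ W.openCell) {b : EuclideanSpace ℝ (Fin n) ≃ᵃⁱ[ℝ] EuclideanSpace ℝ (Fin n)}
    (hb : b ∈ W.coxeterGroup) {w : EuclideanSpace ℝ (Fin n)} (hw : w ∈ W.carrier)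
    (h : dist (b w) p = dist w p) : b w = w := by
  obtain ⟨a, ha, haw, hmin⟩ := hτ.exists_min_dist hp w
  rw [hτ.apply_eq_self ha hw haw] at hmin
  refine hτ.apply_eq_self hb hw fun i => ?_
  by_contra! hi
  have h1 := dist_faceReflection_lt hp hi
  have h2 := hmin _ (mul_mem (faceReflection_mem i) hb)
  rw [AffineIsometryEquiv.coe_mul, Function.comp_apply] at h2
  linarith

/-- Distinct points of an orbit stay away from a given one. -/
theorem exists_separation (hτ : W.IsFolding τ) (w : EuclideanSpace ℝ (Fin n)) :
    ∃ ε > 0, ∀ a ∈ W.coxeterGroup, dist (a w) w < ε → a w = w := by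
  set S := ((fun a : EuclideanSpace ℝ (Fin n) ≃ᵃⁱ[ℝ] EuclideanSpace ℝ (Fin n) => a w) ''
    {a | a ∈ W.coxeterGroup ∧ dist (a w) w ≤ 1}) \ {w} with hS
  have hfin : S.Finite := ((hτ.finite_setOf_dist_le w w 1).image _).sdiff
  obtain ⟨ε, hε, hball⟩ := Metric.isOpen_iff.1 hfin.isClosed.isOpen_compl w (by simp [hS])
  refine ⟨min ε 1, by positivity, fun a ha h => ?_⟩
  by_contra hne
  exact hball (Metric.mem_ball.2 (h.trans_le (min_le_left _ _)))
    ⟨⟨a, ⟨ha, (h.trans_le (min_le_right _ _)).le⟩, rfl⟩, hne⟩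

end IsFolding

end CoxeterPolyhedron

/-! ### Finiteness of the point group and of the set of midpoint types -/

namespace CoxeterPolyhedron

variable {n : ℕ} {W : CoxeterPolyhedron n}

variable (W) in
/-- The unit normals of all mirrors of the tessellation (those conjugate to the walls of `W`). -/
def directions : Set (EuclideanSpace ℝ (Fin n)) :=
  {v | ∃ a ∈ W.coxeterGroup, ∃ i, v = a.linearIsometryEquiv (W.normal i)}

/-- The linear part of `s` is the reflection in the hyperplane orthogonal to the unit vector
`α`. -/
def IsLinearReflection (s : EuclideanSpace ℝ (Fin n) ≃ᵃⁱ[ℝ] EuclideanSpace ℝ (Fin n))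
    (α : EuclideanSpace ℝ (Fin n)) : Prop :=
  ∀ v, s.linearIsometryEquiv v = v - (2 * inner ℝ α v) • α

theorem linearIsometryEquiv_mul_apply
    (a b : EuclideanSpace ℝ (Fin n) ≃ᵃⁱ[ℝ] EuclideanSpace ℝ (Fin n))
    (v : EuclideanSpace ℝ (Fin n)) :
    (a * b).linearIsometryEquiv v = a.linearIsometryEquiv (b.linearIsometryEquiv v) := rfl

theorem linearIsometryEquiv_inv
    (a : EuclideanSpace ℝ (Fin n) ≃ᵃⁱ[ℝ] EuclideanSpace ℝ (Fin n)) :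
    a⁻¹.linearIsometryEquiv = a.linearIsometryEquiv.symm := rfl

theorem IsLinearReflection.conj
    {s : EuclideanSpace ℝ (Fin n) ≃ᵃⁱ[ℝ] EuclideanSpace ℝ (Fin n)}
    {α : EuclideanSpace ℝ (Fin n)} (h : IsLinearReflection s α)
    (a : EuclideanSpace ℝ (Fin n) ≃ᵃⁱ[ℝ] EuclideanSpace ℝ (Fin n)) :
    IsLinearReflection (a * s * a⁻¹) (a.linearIsometryEquiv α) := by
  intro v
  rw [linearIsometryEquiv_mul_apply, linearIsometryEquiv_mul_apply, linearIsometryEquiv_inv, h,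
    map_sub, map_smul, LinearIsometryEquiv.apply_symm_apply,
    ← LinearIsometryEquiv.inner_map_map a.linearIsometryEquiv α,
    LinearIsometryEquiv.apply_symm_apply]

theorem isLinearReflection_faceReflection (i : Fin W.numFacets) :
    IsLinearReflection (W.faceReflection i) (W.normal i) := by
  intro v
  have h := (W.faceReflection i).map_vsub v 0
  rw [vsub_eq_sub, sub_zero, vsub_eq_sub, faceReflection_apply, faceReflection_apply,
    inner_zero_right] at h
  rw [h]
  module

theorem norm_of_mem_directions {α : EuclideanSpace ℝ (Fin n)} (hα : α ∈ W.directions) :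
    ‖α‖ = 1 := by
  obtain ⟨a, -, i, rfl⟩ := hα
  rw [LinearIsometryEquiv.norm_map, W.norm_normal]

/-- Every direction is the normal of the mirror of a reflection in the Coxeter group. -/
theorem exists_reflection {α : EuclideanSpace ℝ (Fin n)} (hα : α ∈ W.directions) :
    ∃ s ∈ W.coxeterGroup, IsLinearReflection s α ∧ ∃ c : ℝ, ∀ z, inner ℝ α z = c → s z = z := by
  obtain ⟨a, ha, i, rfl⟩ := hα
  refine ⟨a * W.faceReflection i * a⁻¹, mul_mem (mul_mem ha (faceReflection_mem i)) (inv_mem ha),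
    (isLinearReflection_faceReflection i).conj a,
    inner ℝ (a.linearIsometryEquiv (W.normal i)) (a (W.offset i • W.normal i)), fun z hz => ?_⟩
  set q := W.offset i • W.normal i with hq
  have h1 : W.faceReflection i q = q := by
    rw [faceReflection_apply, hq, real_inner_smul_right, real_inner_self_eq_norm_sq,
      W.norm_normal]
    module
  have h2 : (a * W.faceReflection i * a⁻¹) (a q) = a q := by
    rw [mul_inv_apply_eq, AffineIsometryEquiv.coe_mul, Function.comp_apply, h1]
  have h3 := (a * W.faceReflection i * a⁻¹).map_vadd (a q) (z - a q)
  rw [h2, (isLinearReflection_faceReflection i).conj a, inner_sub_right, hz, sub_self, mul_zero,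
    zero_smul, sub_zero, vadd_eq_add, sub_add_cancel] at h3
  exact h3

theorem finite_setOf_isLinearReflection
    {S : Set (EuclideanSpace ℝ (Fin n) ≃ᵃⁱ[ℝ] EuclideanSpace ℝ (Fin n))} (hS : S.Finite) :
    {α | ‖α‖ = 1 ∧ ∃ s ∈ S, IsLinearReflection s α}.Finite := by
  have key : ∀ s ∈ S, {α | ‖α‖ = 1 ∧ IsLinearReflection s α}.Finite := by
    intro s _
    rcases Set.eq_empty_or_nonempty {α | ‖α‖ = 1 ∧ IsLinearReflection s α} with h | ⟨β, hβ, hsβ⟩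
    · rw [h]; exact Set.finite_empty
    · refine (Set.toFinite {β, -β}).subset ?_
      rintro α ⟨hα, hsα⟩
      have h1 := (hsα α).symm.trans (hsβ α)
      rw [sub_right_inj, real_inner_self_eq_norm_sq, hα] at h1
      have h2 : α = inner ℝ β α • β := by
        have h3 : (2 : ℝ) • α = (2 : ℝ) • (inner ℝ β α • β) := by
          rw [smul_smul, ← h1]; norm_num
        exact smul_right_injective _ (two_ne_zero (α := ℝ)) h3
      have h4 : |inner ℝ β α| = 1 := by
        have := congrArg norm h2
        rwa [norm_smul, hα, hβ, mul_one, Real.norm_eq_abs, eq_comm] at this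
      rcases eq_or_eq_neg_of_abs_eq h4 with h5 | h5
      · left; rw [h2, h5, one_smul]
      · right; rw [h2, h5, neg_one_smul]; rfl
  refine (hS.biUnion key).subset ?_
  rintro α ⟨hα, s, hs, h⟩
  exact Set.mem_biUnion hs ⟨hα, h⟩

/-- Two hyperplanes that are not parallel meet. -/
theorem exists_inner_eq {V : Type*} [NormedAddCommGroup V] [InnerProductSpace ℝ V] {α β : V}
    (hα : ‖α‖ = 1) (hβ : ‖β‖ = 1) (h1 : inner ℝ α β ≠ 1) (h2 : inner ℝ α β ≠ -1) (c d : ℝ) :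
    ∃ z : V, inner ℝ α z = c ∧ inner ℝ β z = d := by
  set g := inner ℝ α β with hg
  have hne : 1 - g ^ 2 ≠ 0 := by
    have : (1 - g) * (1 + g) ≠ 0 := mul_ne_zero (sub_ne_zero.2 h1.symm)
      (fun h => h2 (by linarith))
    intro h
    exact this (by linarith)
  refine ⟨((c - g * d) / (1 - g ^ 2)) • α + ((d - g * c) / (1 - g ^ 2)) • β, ?_, ?_⟩
  · rw [inner_add_right, real_inner_smul_right, real_inner_smul_right, real_inner_self_eq_norm_sq,
      hα, ← hg]
    field_simp
    ring
  · rw [inner_add_right, real_inner_smul_right, real_inner_smul_right, real_inner_self_eq_norm_sq,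
      hβ, real_inner_comm, ← hg]
    field_simp
    ring

/-- The linear parts of the elements of the Coxeter group. -/
def pointGroup (W : CoxeterPolyhedron n) :
    Set (EuclideanSpace ℝ (Fin n) ≃ₗᵢ[ℝ] EuclideanSpace ℝ (Fin n)) :=
  {g | ∃ a ∈ W.coxeterGroup, a.linearIsometryEquiv = g}

namespace IsFolding

variable {τ : EuclideanSpace ℝ (Fin n) → EuclideanSpace ℝ (Fin n)}

/-- Mirrors meet at finitely many angles: up to the Coxeter group they meet in a point of `W`, and
only finitely many mirrors pass through points of `W`. -/
theorem finite_inner_directions (hτ : W.IsFolding τ) :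
    (Set.image2 (fun α β => inner ℝ α β) W.directions W.directions).Finite := by
  obtain ⟨p, hp⟩ := W.exists_interior
  obtain ⟨D, hD⟩ := W.exists_dist_le (p := p)
  have hfin := finite_setOf_isLinearReflection (hτ.finite_setOf_dist_le p p (2 * D))
  refine ((Set.toFinite {(1 : ℝ), -1}).union
    (Set.Finite.image2 (fun α β => inner ℝ α β) hfin hfin)).subset ?_
  rintro _ ⟨α, hα, β, hβ, rfl⟩
  have hα1 := norm_of_mem_directions hα
  have hβ1 := norm_of_mem_directions hβ
  by_cases h1 : inner ℝ α β = 1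
  · exact Or.inl (Or.inl h1)
  by_cases h2 : inner ℝ α β = -1
  · exact Or.inl (Or.inr h2)
  obtain ⟨s, hs, hsα, e, hse⟩ := exists_reflection hα
  obtain ⟨s', hs', hsβ, e', hse'⟩ := exists_reflection hβ
  obtain ⟨z, hz, hz'⟩ := exists_inner_eq hα1 hβ1 h1 h2 e e'
  obtain ⟨c, hc, hcz, -⟩ := hτ.exists_min_dist hp z
  have key : ∀ r ∈ W.coxeterGroup, ∀ γ, ‖γ‖ = 1 → IsLinearReflection r γ → r z = z →
      c.linearIsometryEquiv γ ∈ {γ | ‖γ‖ = 1 ∧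
        ∃ s ∈ {a | a ∈ W.coxeterGroup ∧ dist (a p) p ≤ 2 * D}, IsLinearReflection s γ} := by
    intro r hr γ hγ hrγ hrz
    refine ⟨by rw [LinearIsometryEquiv.norm_map, hγ], c * r * c⁻¹,
      ⟨mul_mem (mul_mem hc hr) (inv_mem hc), ?_⟩, hrγ.conj c⟩
    have hfix : (c * r * c⁻¹) (c z) = c z := by
      rw [mul_inv_apply_eq, AffineIsometryEquiv.coe_mul, Function.comp_apply, hrz]
    have h3 := dist_triangle ((c * r * c⁻¹) p) ((c * r * c⁻¹) (c z)) p
    rw [(c * r * c⁻¹).dist_map, hfix, dist_comm p] at h3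
    linarith [hD _ hcz]
  refine Or.inr ⟨_, key s hs α hα1 hsα (hse z hz), _, key s' hs' β hβ1 hsβ (hse' z hz'), ?_⟩
  exact LinearIsometryEquiv.inner_map_map _ _ _

theorem finite_directions (hτ : W.IsFolding τ) : W.directions.Finite := by
  have hfin : (Set.image2 (fun α β => inner ℝ α β) W.directions W.directions \ {(1 : ℝ)}).Finite :=
    hτ.finite_inner_directions.sdiff
  obtain ⟨ε, hε, hball⟩ := Metric.isOpen_iff.1 hfin.isClosed.isOpen_compl 1 (by simp)
  refine finite_of_separated (r := min ε 1) (by positivity)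
    ((isCompact_sphere (0 : EuclideanSpace ℝ (Fin n)) 1).totallyBounded.subset fun α hα => ?_) ?_
  · rw [mem_sphere_zero_iff_norm, norm_of_mem_directions hα]
  · intro α hα β hβ h
    have hα1 := norm_of_mem_directions hα
    have hβ1 := norm_of_mem_directions hβ
    rw [← inner_eq_one_iff_of_norm_eq_one (𝕜 := ℝ) hα1 hβ1]
    by_contra hne
    refine hball ?_ ⟨⟨α, hα, β, hβ, rfl⟩, hne⟩
    -- For unit vectors, `‖α - β‖ ^ 2 = 2 * (1 - ⟪α, β⟫)`.
    have h1 := norm_sub_sq_real α β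
    rw [hα1, hβ1, ← dist_eq_norm] at h1
    have h2 := h.trans_le (min_le_left _ _)
    have h3 := h.trans_le (min_le_right _ _)
    have h4 : 0 ≤ dist α β := dist_nonneg
    rw [Metric.mem_ball, Real.dist_eq, abs_lt]
    constructor <;> nlinarith

/-- The point group permutes the finite set of directions, which spans. -/
theorem finite_pointGroup (hτ : W.IsFolding τ) : W.pointGroup.Finite := by
  refine Set.Finite.of_finite_image (f := fun g => fun i => g (W.normal i)) ?_ ?_
  · refine (Set.Finite.pi' fun _ : Fin W.numFacets => hτ.finite_directions).subset ?_
    rintro _ ⟨_, ⟨a, ha, rfl⟩, rfl⟩ i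
    exact ⟨a, ha, i, rfl⟩
  · intro g _ h _ hgh
    ext1 v
    have h0 : v - g.symm (h v) = 0 := by
      refine W.eq_zero_of_inner_normal_eq_zero fun i => ?_
      have h1 : g (W.normal i) = h (W.normal i) := congrFun hgh i
      rw [inner_sub_right, ← g.inner_map_map (W.normal i) (g.symm _), g.apply_symm_apply, h1,
        h.inner_map_map, sub_self]
    rw [sub_eq_zero.1 h0, g.apply_symm_apply, ← sub_eq_zero.1 h0]

/-- The translations in the Coxeter group are coarsely dense: they form a subgroup of finite index,
the kernel of the map to the point group. -/
theorem exists_translation_near (hτ : W.IsFolding τ) :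
    ∃ C, ∀ x : EuclideanSpace ℝ (Fin n), ∃ t,
      AffineIsometryEquiv.constVAdd ℝ (EuclideanSpace ℝ (Fin n)) t ∈ W.coxeterGroup ∧
        ‖x - t‖ ≤ C := by
  have hrep : ∀ g, ∃ C : ℝ, g ∈ W.pointGroup →
      ∃ r ∈ W.coxeterGroup, r.linearIsometryEquiv = g ∧ ∀ w ∈ W.carrier, ‖r w‖ ≤ C := by
    intro g
    by_cases hg : g ∈ W.pointGroup
    · obtain ⟨r, hr, rfl⟩ := hg
      obtain ⟨C, hC⟩ := ((W.isCompact.image r.continuous).isBounded).exists_norm_le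
      exact ⟨C, fun _ => ⟨r, hr, rfl, fun w hw => hC _ ⟨w, hw, rfl⟩⟩⟩
    · exact ⟨0, fun h => absurd h hg⟩
  choose C hC using hrep
  obtain ⟨M, hM⟩ := (hτ.finite_pointGroup.image C).bddAbove
  refine ⟨M, fun x => ?_⟩
  obtain ⟨a, ha, w, hw, rfl⟩ := hτ.exists_eq_apply x
  have hmem : a.linearIsometryEquiv ∈ W.pointGroup := ⟨a, ha, rfl⟩
  obtain ⟨r, hr, hra, hrw⟩ := hC _ hmem
  have htrans : ∀ v, a v = (a 0 - r 0) + r v := by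
    intro v
    have h1 := a.map_vsub v 0
    have h2 := r.map_vsub v 0
    rw [hra, h1, vsub_eq_sub, vsub_eq_sub] at h2
    rw [sub_add_eq_add_sub, add_sub_assoc, ← h2]
    abel
  refine ⟨a 0 - r 0, ?_, ?_⟩
  · convert mul_mem ha (inv_mem hr) using 1
    ext1 v
    rw [AffineIsometryEquiv.coe_mul, Function.comp_apply, htrans (r⁻¹ v),
      show r (r⁻¹ v) = v from r.apply_symm_apply v]
    rfl
  · rw [htrans w, add_sub_cancel_left]
    exact (hrw w hw).trans (hM ⟨_, hmem, rfl⟩)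

/-- The doubles of the translations form a subgroup of finite index. -/
theorem exists_finite_representatives (hτ : W.IsFolding τ) :
    ∃ R : Set (EuclideanSpace ℝ (Fin n) ≃ᵃⁱ[ℝ] EuclideanSpace ℝ (Fin n)), R.Finite ∧
      ∀ b ∈ W.coxeterGroup, ∃ r ∈ R, ∃ t,
        AffineIsometryEquiv.constVAdd ℝ (EuclideanSpace ℝ (Fin n)) t ∈ W.coxeterGroup ∧
          ∀ x, b x = (t + t) + r x := by
  obtain ⟨C, hC⟩ := hτ.exists_translation_near
  refine ⟨_, hτ.finite_setOf_dist_le 0 0 (2 * C), fun b hb => ?_⟩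
  obtain ⟨t, ht, htC⟩ := hC ((1 / 2 : ℝ) • b 0)
  set T := AffineIsometryEquiv.constVAdd ℝ (EuclideanSpace ℝ (Fin n)) t with hT
  have hTx : ∀ x, T x = t + x := fun x => rfl
  have hb' : ∀ x, b x = (t + t) + (T⁻¹ * T⁻¹ * b) x := by
    intro x
    have h1 : (T * T * (T⁻¹ * T⁻¹ * b)) x = b x := by
      rw [show T * T * (T⁻¹ * T⁻¹ * b) = b by group]
    rw [← h1, AffineIsometryEquiv.coe_mul, AffineIsometryEquiv.coe_mul, Function.comp_apply,
      Function.comp_apply, hTx, hTx, add_assoc]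
  refine ⟨T⁻¹ * T⁻¹ * b, ⟨mul_mem (mul_mem (inv_mem ht) (inv_mem ht)) hb, ?_⟩, t, ht, hb'⟩
  have h2 : (T⁻¹ * T⁻¹ * b) 0 = (2 : ℝ) • ((1 / 2 : ℝ) • b 0 - t) := by
    rw [smul_sub, smul_smul, hb' 0]
    module
  rw [dist_zero_right, h2, norm_smul, Real.norm_eq_abs, abs_two]
  linarith

/-- Up to the Coxeter group the midpoints have the form `(u + b v) / 2`, and a change of `b` by the
translation by `2 t` moves this midpoint by `t`. -/
theorem exists_encard_midpointTypes_le (hτ : W.IsFolding τ) :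
    ∃ N : ℕ, ∀ u v, (W.midpointTypes u v).encard ≤ N := by
  obtain ⟨R, hR, h⟩ := hτ.exists_finite_representatives
  refine ⟨R.ncard, fun u v => ?_⟩
  rw [hR.cast_ncard_eq]
  refine (Set.encard_le_encard (t := (fun r => τ (midpoint ℝ u (r v))) '' R) ?_).trans
    (Set.encard_image_le _ _)
  rintro w ⟨hw, a, ha, b, hb, c, hc, hcw⟩
  obtain ⟨r, hr, t, ht, hbr⟩ := h (a⁻¹ * b) (mul_mem (inv_mem ha) hb)
  refine ⟨r, hr, ?_⟩
  set T := AffineIsometryEquiv.constVAdd ℝ (EuclideanSpace ℝ (Fin n)) t with hT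
  have h1 : (a * T) (midpoint ℝ u (r v)) = c w := by
    have h2 : T (midpoint ℝ u (r v)) = midpoint ℝ u ((a⁻¹ * b) v) := by
      rw [hbr, midpoint_eq_smul_add, midpoint_eq_smul_add]
      change t + _ = _
      rw [invOf_eq_inv]
      module
    rw [AffineIsometryEquiv.coe_mul, Function.comp_apply, h2, hcw,
      ← a.coe_toAffineEquiv, AffineEquiv.map_midpoint, a.coe_toAffineEquiv, apply_inv_mul_apply]
  have h4 : midpoint ℝ u (r v) = ((a * T)⁻¹ * c) w := by
    rw [AffineIsometryEquiv.coe_mul, Function.comp_apply, ← h1, AffineIsometryEquiv.coe_inv,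
      AffineIsometryEquiv.symm_apply_apply]
  exact (congrArg τ h4).trans <| hτ _ (mul_mem (inv_mem (mul_mem ha ht)) hc) w hw

end IsFolding

end CoxeterPolyhedron

/-! ### Points of a given type in a building and in its quotient -/

namespace LabelledComplex

variable {n : ℕ} {W : CoxeterPolyhedron n} {X : Type*} [MetricSpace X]

theorem IsApartmentEmbedding.isFolding {K : LabelledComplex W X} {f : EuclideanSpace ℝ (Fin n) → X}
    (hf : K.IsApartmentEmbedding f) : W.IsFolding (fun x => K.type (f x)) :=
  fun a ha w hw => (hf.2 a ha).2 w hw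

theorem IsApartmentEmbedding.exists_eq {K : LabelledComplex W X}
    {f : EuclideanSpace ℝ (Fin n) → X} (hf : K.IsApartmentEmbedding f)
    (x : EuclideanSpace ℝ (Fin n)) :
    ∃ a ∈ W.coxeterGroup, K.type (f x) ∈ W.carrier ∧ x = a (K.type (f x)) := by
  obtain ⟨a, ha, w, hw, rfl⟩ := hf.isFolding.exists_eq_apply x
  have : K.type (f (a w)) = w := (hf.2 a ha).2 w hw
  exact ⟨a, ha, by rwa [this], by rw [this]⟩

theorem type_mem_carrier (K : LabelledComplex W X) (x : X) : K.type x ∈ W.carrier := by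
  obtain ⟨C, hC, hx⟩ := K.exists_chamber x
  rw [← K.type_image C hC]
  exact ⟨x, hx, rfl⟩

theorem eq_of_type_eq (K : LabelledComplex W X) {C : Set X} (hC : C ∈ K.chambers) {x y : X}
    (hx : x ∈ C) (hy : y ∈ C) (h : K.type x = K.type y) : x = y := by
  rw [← dist_eq_zero, ← K.dist_type C hC x hx y hy, h, dist_self]

/-- A point of open type lies in one chamber only. -/
theorem chamber_subset (K : LabelledComplex W X) {C C' : Set X} (hC : C ∈ K.chambers)
    (hC' : C' ∈ K.chambers) {c : X} (hcC : c ∈ C) (hcC' : c ∈ C')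
    (hc : K.type c ∈ W.openCell) : C ⊆ C' := by
  obtain ⟨J, hJ⟩ := K.inter_chambers C hC C' hC' ⟨c, hcC, hcC'⟩
  have h1 : c ∈ C ∩ C' := ⟨hcC, hcC'⟩
  rw [hJ] at h1
  intro x hx
  have h2 : x ∈ C ∩ C' := by
    rw [hJ]
    exact ⟨hx, K.type_mem_carrier x, fun j hj => absurd (h1.2.2 j hj) (hc j).ne⟩
  exact h2.2

end LabelledComplex

namespace EuclideanBuilding

variable {n : ℕ} {W : CoxeterPolyhedron n} {X : Type*} [MetricSpace X]

/-- Any two points are placed as two points of the tessellated Euclidean space. -/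
theorem exists_coordinates (B : EuclideanBuilding W X) (x y : X) :
    ∃ f, B.IsApartmentEmbedding f ∧ ∃ a ∈ W.coxeterGroup, ∃ b ∈ W.coxeterGroup,
      f (a (B.type x)) = x ∧ f (b (B.type y)) = y := by
  obtain ⟨f, hf, ⟨x', rfl⟩, ⟨y', rfl⟩⟩ := B.exists_apartment x y
  obtain ⟨a, ha, -, hx⟩ := hf.exists_eq x'
  obtain ⟨b, hb, -, hy⟩ := hf.exists_eq y'
  exact ⟨f, hf, a, ha, b, hb, by rw [← hx], by rw [← hy]⟩

theorem exists_isFolding (B : EuclideanBuilding W X) [Nonempty X] : ∃ τ, W.IsFolding τ := by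
  obtain ⟨x⟩ := ‹Nonempty X›
  obtain ⟨f, hf, -⟩ := B.exists_apartment x x
  exact ⟨_, hf.isFolding⟩

theorem exists_separation (B : EuclideanBuilding W X) (w : EuclideanSpace ℝ (Fin n)) :
    ∃ ε > 0, ∀ x y : X, B.type x = w → B.type y = w → dist x y < ε → x = y := by
  rcases isEmpty_or_nonempty X with hX | hX
  · exact ⟨1, one_pos, fun x => hX.elim x⟩
  obtain ⟨τ, hτ⟩ := B.exists_isFolding
  obtain ⟨ε, hε, h⟩ := hτ.exists_separation w
  refine ⟨ε, hε, fun x y hx hy hxy => ?_⟩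
  obtain ⟨f, hf, a, ha, b, hb, hfa, hfb⟩ := B.exists_coordinates x y
  rw [← hfa, ← hfb, hf.1.dist_eq, hx, hy, ← CoxeterPolyhedron.dist_inv_mul_apply] at hxy
  have h1 := h _ (mul_mem (inv_mem hb) ha) hxy
  rw [← hfa, ← hfb, hx, hy, ← CoxeterPolyhedron.apply_inv_mul_apply (a := b) (b := a), h1]

/-- In the chamber around a point `c` of open type there is just one point of type `w`, and it is
the only point of type `w` at its distance from `c` in the whole building. -/
theorem eq_of_dist_eq (B : EuclideanBuilding W X) {c x y : X} (hc : B.type c ∈ W.openCell)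
    (hxy : B.type x = B.type y) (hx : dist x c = dist (B.type x) (B.type c))
    (hy : dist y c = dist (B.type y) (B.type c)) : x = y := by
  have key : ∀ z, dist z c = dist (B.type z) (B.type c) → ∃ C ∈ B.chambers, c ∈ C ∧ z ∈ C := by
    intro z hz
    obtain ⟨f, hf, b, hb, a, ha, hfz, hfc⟩ := B.exists_coordinates z c
    have h1 : (a⁻¹ * b) (B.type z) = B.type z := by
      refine hf.isFolding.apply_eq_of_dist_eq hc (mul_mem (inv_mem ha) hb)
        (B.type_mem_carrier z) ?_
      rw [CoxeterPolyhedron.dist_inv_mul_apply, ← hf.1.dist_eq, hfz, hfc, hz]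
    have h2 : b (B.type z) = a (B.type z) := by
      conv_rhs => rw [← h1]
      rw [CoxeterPolyhedron.apply_inv_mul_apply]
    exact ⟨_, (hf.2 a ha).1, ⟨_, ⟨_, B.type_mem_carrier c, rfl⟩, hfc⟩,
      ⟨_, ⟨_, B.type_mem_carrier z, rfl⟩, by rw [← h2, hfz]⟩⟩
  obtain ⟨C, hC, hcC, hxC⟩ := key x hx
  obtain ⟨C', hC', hcC', hyC'⟩ := key y hy
  exact B.eq_of_type_eq hC' (B.chamber_subset hC hC' hcC hcC' hc hxC) hyC' hxy

end EuclideanBuilding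

namespace OrbitSpace

variable {X : Type*} [MetricSpace X] {Γ : Subgroup (X ≃ᵢ X)}

theorem dist_mk_le (x y : X) : dist (mk Γ x) (mk Γ y) ≤ dist x y :=
  csInf_le (qdist_bddBelow _ _) ⟨x, y, rfl, rfl, rfl⟩

theorem exists_lift {p : X} {q : OrbitSpace Γ} {r : ℝ} (h : dist (mk Γ p) q < r) :
    ∃ y, mk Γ y = q ∧ dist p y < r := by
  obtain ⟨_, ⟨x, y, hx, hy, rfl⟩, hlt⟩ := exists_lt_of_csInf_lt (qdist_nonempty _ _) h
  obtain ⟨g, hg, hgx⟩ := mk_eq_mk.1 hx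
  refine ⟨g y, ?_, ?_⟩
  · rw [← hy]; exact (mk_eq_mk.2 ⟨g, hg, rfl⟩).symm
  · rwa [← hgx, g.dist_eq]

/-- If nontrivial elements of `Γ` move all points by at least `2 * ε`, then the projection preserves
distances less than `ε`. -/
theorem dist_mk_eq {ε : ℝ} (hε : ∀ g ∈ Γ, g ≠ 1 → ∀ x, 2 * ε ≤ dist x (g x)) {x y : X}
    (h : dist x y < ε) : dist (mk Γ x) (mk Γ y) = dist x y := by
  refine le_antisymm (dist_mk_le x y) (le_of_not_gt fun hlt => ?_)
  obtain ⟨z, hz, hxz⟩ := exists_lift hlt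
  obtain ⟨g, hg, hgz⟩ := mk_eq_mk.1 hz.symm
  by_cases hg1 : g = 1
  · rw [hg1] at hgz
    have hyz : y = z := hgz
    rw [hyz] at hxz
    exact lt_irrefl _ hxz
  · have h1 := hε g hg hg1 y
    have h2 := dist_triangle_left y (g y) x
    rw [hgz] at h1 h2
    linarith

end OrbitSpace

namespace EuclideanBuilding

variable {n : ℕ} {W : CoxeterPolyhedron n} {X : Type*} [MetricSpace X]
  {Γ : Subgroup (X ≃ᵢ X)}

/-- A free cocompact group of label-preserving isometries acts with a positive injectivity
radius. -/
theorem exists_le_dist_apply (B : EuclideanBuilding W X) (hΓ : Γ ≤ B.isom)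
    (hfree : ∀ g ∈ Γ, ∀ x : X, g x = x → g = 1) (hcompact : CompactSpace (OrbitSpace Γ)) :
    ∃ ε > 0, ∀ g ∈ Γ, g ≠ 1 → ∀ x, ε ≤ dist x (g x) := by
  let P : Set (OrbitSpace Γ) → Prop := fun s =>
    ∃ ε > 0, ∀ g ∈ Γ, g ≠ 1 → ∀ x, OrbitSpace.mk Γ x ∈ s → ε ≤ dist x (g x)
  have hP : P Set.univ := by
    refine isCompact_univ.induction_on ⟨1, one_pos, fun _ _ _ _ h => h.elim⟩ ?_ ?_ ?_
    · rintro s t hst ⟨ε, hε, h⟩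
      exact ⟨ε, hε, fun g hg hg1 x hx => h g hg hg1 x (hst hx)⟩
    · rintro s t ⟨ε, hε, h⟩ ⟨ε', hε', h'⟩
      refine ⟨min ε ε', lt_min hε hε', fun g hg hg1 x hx => ?_⟩
      rcases hx with hx | hx
      · exact (min_le_left _ _).trans (h g hg hg1 x hx)
      · exact (min_le_right _ _).trans (h' g hg hg1 x hx)
    · intro q _
      obtain ⟨y, rfl⟩ := OrbitSpace.mk_surjective q
      obtain ⟨ε, hε, hsep⟩ := B.exists_separation (B.type y)
      refine ⟨_, mem_nhdsWithin_of_mem_nhds (Metric.ball_mem_nhds _ (by positivity : 0 < ε / 4)),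
        ε / 2, by positivity, fun g hg hg1 x hx => ?_⟩
      rw [Metric.mem_ball'] at hx
      obtain ⟨z, hz, hyz⟩ := OrbitSpace.exists_lift hx
      obtain ⟨k, hk, hkx⟩ := OrbitSpace.mk_eq_mk.1 hz
      -- The point `z = k⁻¹ x` is close to `y`, and `k⁻¹ g k` moves it as far as `g` moves `x`.
      by_contra! hlt
      have h1 : (k⁻¹ * g * k) y ≠ y := fun h => hg1 (by
        have := hfree _ (Γ.mul_mem (Γ.mul_mem (Γ.inv_mem hk) hg) hk) y h
        rwa [mul_assoc, inv_mul_eq_one, eq_comm, mul_eq_right] at this)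
      refine h1 (hsep _ _ ?_ rfl ?_)
      · exact hΓ (Γ.mul_mem (Γ.mul_mem (Γ.inv_mem hk) hg) hk) y
      · have h2 : dist z ((k⁻¹ * g * k) z) = dist x (g x) := by
          rw [← k.dist_eq, hkx]
          change dist x (k (k⁻¹ (g (k z)))) = _
          rw [IsometryEquiv.apply_inv_self, hkx]
        have h3 := dist_triangle4 ((k⁻¹ * g * k) y) ((k⁻¹ * g * k) z) z y
        rw [IsometryEquiv.dist_eq, dist_comm ((k⁻¹ * g * k) z) z, h2, dist_comm z y] at h3
        linarith
  obtain ⟨ε, hε, h⟩ := hP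
  exact ⟨ε, hε, fun g hg hg1 x => h g hg hg1 x trivial⟩

/-- The quotient has finitely many points of a given type. -/
theorem finite_setOf_quotientType_eq (B : EuclideanBuilding W X) (hΓ : Γ ≤ B.isom)
    (hcompact : CompactSpace (OrbitSpace Γ)) (w : EuclideanSpace ℝ (Fin n)) :
    {q : OrbitSpace Γ | B.quotientType Γ hΓ q = w}.Finite := by
  obtain ⟨ε, hε, hsep⟩ := B.exists_separation w
  refine finite_of_separated hε (isCompact_univ.totallyBounded.subset (Set.subset_univ _)) ?_
  intro q hq q' hq' h
  obtain ⟨x, rfl⟩ := OrbitSpace.mk_surjective q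
  obtain ⟨y, hy, hxy⟩ := OrbitSpace.exists_lift h
  subst hy
  rw [hsep x y hq hq' hxy]

/-- The quotient has at most as many points of one type as it has points of a fixed type in the open
cell, that is, as it has chambers. -/
theorem exists_encard_quotientType_le (B : EuclideanBuilding W X) (hΓ : Γ ≤ B.isom)
    (hcompact : CompactSpace (OrbitSpace Γ)) :
    ∃ k : ℕ, ∀ w, {q : OrbitSpace Γ | B.quotientType Γ hΓ q = w}.encard ≤ k := by
  obtain ⟨p, hp⟩ := W.exists_interior
  have hfin := B.finite_setOf_quotientType_eq hΓ hcompact p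
  refine ⟨Set.ncard {q : OrbitSpace Γ | B.quotientType Γ hΓ q = p}, fun w => ?_⟩
  rw [hfin.cast_ncard_eq]
  have hcenter : ∀ q : OrbitSpace Γ, ∃ c x, OrbitSpace.mk Γ x = q ∧ B.type c = p ∧
      dist x c = dist (B.type x) (B.type c) := by
    intro q
    obtain ⟨x, rfl⟩ := OrbitSpace.mk_surjective q
    obtain ⟨C, hC, hx⟩ := B.exists_chamber x
    obtain ⟨c, hc, hcp⟩ : p ∈ B.type '' C := by
      rw [B.type_image C hC]
      exact CoxeterPolyhedron.openCell_subset hp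
    exact ⟨c, x, rfl, hcp, (B.dist_type C hC x hx c hc).symm⟩
  choose c x hxq hcp hxc using hcenter
  refine Set.encard_le_encard_of_injOn (f := fun q => OrbitSpace.mk Γ (c q)) (fun q _ => hcp q) ?_
  intro q hq q' hq' h
  obtain ⟨g, hg, hgc⟩ := OrbitSpace.mk_eq_mk.1 h
  have htype : ∀ q, B.type (x q) = B.quotientType Γ hΓ q := fun q => by
    conv_rhs => rw [← hxq q]
    rfl
  have hgx : B.type (g (x q)) = B.type (x q) := hΓ hg _
  have hgc' : B.type (g (c q)) = B.type (c q) := hΓ hg _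
  have h1 : g (x q) = x q' := by
    refine B.eq_of_dist_eq (c := c q') (by rw [hcp]; exact hp) ?_ ?_ (hxc q')
    · rw [hgx, htype, htype, hq, hq']
    · rw [← hgc, g.dist_eq, hxc, hgx, hgc']
  rw [← hxq q, ← hxq q', ← h1]
  exact OrbitSpace.mk_eq_mk.2 ⟨g, hg, rfl⟩

end EuclideanBuilding

/-! ### Geodesics in the quotient -/

/-- A geodesic segment minimizes distances on all subintervals of some fixed length. -/
theorem IsGeodesicSegment.exists_forall_dist_eq {Y : Type*} [PseudoMetricSpace Y] {γ : ℝ → Y}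
    {L : ℝ} (hγ : IsGeodesicSegment γ L) :
    ∃ η > 0, ∀ s ∈ Set.Icc 0 L, ∀ s' ∈ Set.Icc 0 L, |s - s'| < η →
      dist (γ s) (γ s') = |s - s'| := by
  choose ε hε h using hγ.2
  obtain ⟨η, hη, hball⟩ := lebesgue_number_lemma_of_metric (isCompact_Icc (a := 0) (b := L))
    (c := fun t : Set.Icc 0 L => Metric.ball (t : ℝ) (ε t t.2)) (fun _ => Metric.isOpen_ball)
    (fun t ht => Set.mem_iUnion.2 ⟨⟨t, ht⟩, Metric.mem_ball_self (hε t ht)⟩)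
  refine ⟨η, hη, fun s hs s' hs' hss' => ?_⟩
  obtain ⟨t, ht⟩ := hball s hs
  exact h t t.2 s hs s' hs' (ht (Metric.mem_ball_self hη))
    (ht (by rwa [Metric.mem_ball', Real.dist_eq]))

theorem OrbitSpace.exists_lift_chain {X : Type*} [MetricSpace X] {Γ : Subgroup (X ≃ᵢ X)} {ε : ℝ}
    (p : ℕ → OrbitSpace Γ) (h : ∀ k, dist (p k) (p (k + 1)) < ε) :
    ∃ x : ℕ → X, ∀ k, mk Γ (x k) = p k ∧ dist (x k) (x (k + 1)) < ε := by
  obtain ⟨x₀, hx₀⟩ := mk_surjective (p 0)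
  have hstep : ∀ k (x : {x : X // mk Γ x = p k}), ∃ y : {y : X // mk Γ y = p (k + 1)},
      dist (x : X) y < ε := by
    rintro k ⟨x, hx⟩
    obtain ⟨y, hy, hxy⟩ := exists_lift (p := x) (q := p (k + 1)) (hx ▸ h k)
    exact ⟨⟨y, hy⟩, hxy⟩
  choose next hnext using hstep
  let x : ∀ k, {x : X // mk Γ x = p k} := fun k => Nat.rec ⟨x₀, hx₀⟩ next k
  exact ⟨fun k => (x k).1, fun k => ⟨(x k).2, hnext k (x k)⟩⟩

namespace EuclideanBuilding

variable {n : ℕ} {W : CoxeterPolyhedron n} {X : Type*} [MetricSpace X]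
  {Γ : Subgroup (X ≃ᵢ X)}

/-- The midpoint of two points of a building is their midpoint in any apartment that contains
them. -/
theorem type_mem_midpointTypes (B : EuclideanBuilding W X) {x y m : X}
    (hx : dist x m = dist x y / 2) (hy : dist y m = dist x y / 2) :
    B.type m ∈ W.midpointTypes (B.type x) (B.type y) := by
  obtain ⟨f, hf, a, ha, b, hb, hfa, hfb⟩ := B.exists_coordinates x y
  have hm : f (midpoint ℝ (a (B.type x)) (b (B.type y))) = m := by
    refine B.isCAT0.midpoint_unique ?_ ?_ hx hy
    · nth_rw 1 [← hfa]
      rw [hf.1.dist_eq, dist_left_midpoint, ← hf.1.dist_eq, hfa, hfb, Real.norm_ofNat]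
      ring
    · nth_rw 1 [← hfb]
      rw [hf.1.dist_eq, dist_right_midpoint, ← hf.1.dist_eq, hfa, hfb, Real.norm_ofNat]
      ring
  obtain ⟨c, hc, -, hcm⟩ := hf.exists_eq (midpoint ℝ (a (B.type x)) (b (B.type y)))
  rw [hm] at hcm
  exact ⟨B.type_mem_carrier m, a, ha, b, hb, c, hc, hcm.symm⟩

/-- Lifting finely spaced points of a geodesic of the quotient gives a chain in the building that is
straight, hence a minimizing geodesic, with its middle point over the midpoint of the given
geodesic. -/
theorem quotientType_midpoint_mem (B : EuclideanBuilding W X) (hΓ : Γ ≤ B.isom)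
    (hfree : ∀ g ∈ Γ, ∀ x : X, g x = x → g = 1) (hcompact : CompactSpace (OrbitSpace Γ))
    {γ : ℝ → OrbitSpace Γ} {L : ℝ} (hγ : IsGeodesicSegment γ L) :
    B.quotientType Γ hΓ (γ (L / 2)) ∈
      W.midpointTypes (B.quotientType Γ hΓ (γ 0)) (B.quotientType Γ hΓ (γ L)) := by
  have hL : 0 < L := hγ.1
  obtain ⟨δ, hδ, hδdist⟩ := B.exists_le_dist_apply hΓ hfree hcompact
  obtain ⟨η, hη, hηdist⟩ := hγ.exists_forall_dist_eq
  set ε := δ / 2 with hε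
  have hε0 : 0 < ε := half_pos hδ
  have hεdist : ∀ g ∈ Γ, g ≠ 1 → ∀ x, 2 * ε ≤ dist x (g x) := by
    intro g hg hg1 x
    rw [hε, mul_div_cancel₀ _ two_ne_zero]
    exact hδdist g hg hg1 x
  obtain ⟨M, hM⟩ := exists_nat_gt (L / min η ε)
  have hmin : 0 < min η ε := lt_min hη hε0
  have hM0 : (0 : ℝ) < M := (div_pos hL hmin).trans hM
  set h := L / (2 * M) with hh
  have hh0 : 0 < h := by positivity
  have hMh : M * h = L / 2 := by rw [hh]; field_simp
  have h2h : 2 * h < min η ε := by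
    rw [div_lt_iff₀ hmin] at hM
    rw [hh, show 2 * (L / (2 * M)) = L / M by field_simp, div_lt_iff₀ hM0, mul_comm]
    exact hM
  have h2η : 2 * h < η := h2h.trans_le (min_le_left _ _)
  have h2ε : 2 * h < ε := h2h.trans_le (min_le_right _ _)
  -- The times are cut off at `L`, so that the sequence is defined for all `k`.
  set t : ℕ → ℝ := fun k => min (k * h) L with ht
  have htmem : ∀ k, t k ∈ Set.Icc 0 L := fun k =>
    ⟨le_min (by positivity) hL.le, min_le_right _ _⟩
  have hteq : ∀ k, k ≤ 2 * M → t k = k * h := by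
    intro k hk
    refine min_eq_left ?_
    have : (k : ℝ) ≤ 2 * M := by exact_mod_cast hk
    nlinarith
  have htstep : ∀ k, |t k - t (k + 1)| ≤ h := by
    intro k
    have h1 := abs_min_sub_min_le_max (k * h) L ((k + 1 : ℕ) * h) L
    rw [sub_self, abs_zero, max_eq_left (abs_nonneg _)] at h1
    refine h1.trans_eq ?_
    rw [← sub_mul, abs_mul, abs_of_pos hh0]
    push_cast
    rw [sub_add_cancel_left, abs_neg, abs_one, one_mul]
  have hpstep : ∀ k, dist (γ (t k)) (γ (t (k + 1))) < ε := by
    intro k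
    rw [hηdist _ (htmem k) _ (htmem (k + 1)) ((htstep k).trans_lt (by linarith))]
    exact (htstep k).trans_lt (by linarith)
  obtain ⟨x, hx⟩ := OrbitSpace.exists_lift_chain (fun k => γ (t k)) hpstep
  have h1 : ∀ k < 2 * M, dist (x k) (x (k + 1)) = h := by
    intro k hk
    have he : |t k - t (k + 1)| = h := by
      rw [hteq k hk.le, hteq (k + 1) hk]
      push_cast
      rw [show (k : ℝ) * h - (k + 1) * h = -h by ring, abs_neg, abs_of_pos hh0]
    rw [← OrbitSpace.dist_mk_eq hεdist (hx k).2, (hx k).1, (hx (k + 1)).1,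
      hηdist _ (htmem k) _ (htmem (k + 1)) (by rw [he]; linarith), he]
  have h2 : ∀ k, k + 1 < 2 * M → dist (x k) (x (k + 2)) = 2 * h := by
    intro k hk
    have he : |t k - t (k + 2)| = 2 * h := by
      rw [hteq k (by omega), hteq (k + 2) hk]
      push_cast
      rw [show (k : ℝ) * h - (k + 2) * h = -(2 * h) by ring, abs_neg, abs_of_pos (by positivity)]
    have hlt : dist (x k) (x (k + 2)) < ε := by
      have := dist_triangle (x k) (x (k + 1)) (x (k + 1 + 1))
      rw [h1 k (by omega), h1 (k + 1) hk] at this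
      exact this.trans_lt (by linarith)
    rw [← OrbitSpace.dist_mk_eq hεdist hlt, (hx k).1, (hx (k + 2)).1,
      hηdist _ (htmem k) _ (htmem (k + 2)) (by rw [he]; linarith), he]
  have hchain := B.isCAT0.dist_chain x (2 * M) h1 h2
  have hd1 : dist (x 0) (x M) = L / 2 := by rw [hchain M (by omega), hMh]
  have hd2 : dist (x 0) (x (2 * M)) = L := by
    rw [hchain _ le_rfl]; push_cast; linarith
  have hd3 : dist (x M) (x (M + M)) = L / 2 := by
    rw [← hMh]
    exact B.isCAT0.dist_chain (fun k => x (M + k)) M (fun k hk => h1 (M + k) (by omega))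
      (fun k hk => h2 (M + k) (by omega)) M le_rfl
  rw [← two_mul, dist_comm] at hd3
  have hmain := B.type_mem_midpointTypes (x := x 0) (y := x (2 * M)) (m := x M)
    (by rw [hd1, hd2]) (by rw [hd3, hd2])
  have htype : ∀ k, B.type (x k) = B.quotientType Γ hΓ (γ (t k)) := fun k => by
    rw [← (hx k).1]
    rfl
  rw [htype, htype, htype, hteq M (by omega), hteq 0 (by omega), hteq _ le_rfl, hMh] at hmain
  push_cast at hmain
  rw [zero_mul, mul_assoc, hMh, mul_div_cancel₀ _ two_ne_zero] at hmain
  exact hmain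

end EuclideanBuilding

theorem blockingNumber_le {Y : Type*} [PseudoMetricSpace Y] {x y : Y} {F : Set Y}
    (hF : IsBlockingSet F {x} {y}) : blockingNumber x y ≤ F.encard :=
  sInf_le ⟨F, hF, rfl⟩

theorem theorem1 {n : ℕ} (W : CoxeterPolyhedron n) {X : Type*} [MetricSpace X]
    (B : EuclideanBuilding W X) (Γ : Subgroup (X ≃ᵢ X)) (hΓ : Γ ≤ B.isom)
    (hfree : ∀ g ∈ Γ, ∀ x : X, g x = x → g = 1)
    (hcompact : CompactSpace (OrbitSpace Γ)) :
    UniformFiniteBlocking (OrbitSpace Γ) ∧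
    ∃ N : ℕ, ∀ x y : OrbitSpace Γ,
      (W.midpointTypes (B.quotientType Γ hΓ x) (B.quotientType Γ hΓ y)).encard ≤ N ∧
      {p : OrbitSpace Γ | B.quotientType Γ hΓ p ∈
        W.midpointTypes (B.quotientType Γ hΓ x) (B.quotientType Γ hΓ y)}.encard ≤ N ∧
      ∀ (γ : ℝ → OrbitSpace Γ) (L : ℝ), IsGeodesicFromTo {x} {y} γ L →
        B.quotientType Γ hΓ (γ (L / 2)) ∈
          W.midpointTypes (B.quotientType Γ hΓ x) (B.quotientType Γ hΓ y) := by
  rcases isEmpty_or_nonempty X with hX | hX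
  · have hempty : ∀ q : OrbitSpace Γ, False := fun q =>
      (OrbitSpace.mk_surjective q).elim fun x _ => hX.elim x
    exact ⟨⟨fun x => (hempty x).elim, 0, fun x => (hempty x).elim⟩, 0, fun x => (hempty x).elim⟩
  obtain ⟨τ, hτ⟩ := B.exists_isFolding
  obtain ⟨N, hN⟩ := hτ.exists_encard_midpointTypes_le
  obtain ⟨k, hk⟩ := B.exists_encard_quotientType_le hΓ hcompact
  have hpoints : ∀ x y : OrbitSpace Γ, {p : OrbitSpace Γ | B.quotientType Γ hΓ p ∈
      W.midpointTypes (B.quotientType Γ hΓ x) (B.quotientType Γ hΓ y)}.encard ≤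
        (N * k : ℕ) := by
    intro x y
    set T := W.midpointTypes (B.quotientType Γ hΓ x) (B.quotientType Γ hΓ y)
    have hT : T.encard ≤ N := hN _ _
    have hTfin : T.Finite := Set.finite_of_encard_le_coe hT
    have hunion : {p : OrbitSpace Γ | B.quotientType Γ hΓ p ∈ T} =
        ⋃ w ∈ hTfin.toFinset, {p : OrbitSpace Γ | B.quotientType Γ hΓ p = w} := by
      ext p
      simp
    rw [hunion]
    refine (Finset.set_encard_biUnion_le _ _).trans ?_
    refine (Finset.sum_le_card_nsmul _ _ (k : ℕ∞) fun w _ => hk w).trans ?_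
    rw [nsmul_eq_mul, Nat.cast_mul, ← Set.encard_coe_eq_coe_finsetCard, hTfin.coe_toFinset]
    gcongr
  have hmid : ∀ (x y : OrbitSpace Γ) (γ : ℝ → OrbitSpace Γ) (L : ℝ),
      IsGeodesicFromTo {x} {y} γ L → B.quotientType Γ hΓ (γ (L / 2)) ∈
        W.midpointTypes (B.quotientType Γ hΓ x) (B.quotientType Γ hΓ y) := by
    rintro x y γ L ⟨hγ, rfl, rfl⟩
    exact B.quotientType_midpoint_mem hΓ hfree hcompact hγ
  have hblock : ∀ x y : OrbitSpace Γ, blockingNumber x y ≤ (N * k : ℕ) := by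
    intro x y
    refine (blockingNumber_le fun γ L hγ => ?_).trans (hpoints x y)
    have hL : 0 < L := hγ.1.1.1
    exact ⟨γ (L / 2), ⟨L / 2, ⟨half_pos hL, half_lt_self hL⟩, rfl⟩, hmid x y γ L hγ.1⟩
  refine ⟨⟨fun x y => (hblock x y).trans_lt (ENat.natCast_lt_top _), _, hblock⟩, max N (N * k),
    fun x y => ⟨(hN _ _).trans ?_, (hpoints x y).trans ?_, hmid x y⟩⟩
  · exact_mod_cast le_max_left _ _
  · exact_mod_cast le_max_right _ _
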